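/- Let $\mathbb F_q$ be the finite field with $q$ elements, where $q$ is a prime power divisible by neither $2$ nor $3$. Call an element $g$ of $SL_2(\mathbb F_q)$ a cube if $g=x^3$ for some $x\in SL_2(\mathbb F_q)$, and call a conjugacy class of $SL_2(\mathbb F_q)$ a cube if its elements are cubes. Let $c(3,q)$ be the number of conjugacy classes of $SL_2(\mathbb F_q)$ that are cubes, and let $s(3,q)$ be the number of elements of $SL_2(\mathbb F_q)$ that are cubes. Then: 1. $c(3,q)=\dfrac{2q+13}{3}$ if $3\mid q-1$, and $c(3,q)=\dfrac{2q+11}{3}$ if $3\mid q+1$. 2. The proportion of conjugacy classes of $SL_2(\mathbb F_q)$ that are cubes, i.e. $c(3,q)$ divided by the number of all conjugacy classes of $SL_2(\mathbb F_q)$, tends to $\dfrac23$ as $q\to\infty$ through prime powers divisible by neither $2$ nor $3$. 3. $s(3,q)=\dfrac{2q(q^2-1)}{3}$. 4. $\dfrac{s(3,q)}{|SL_2(\mathbb F_q)|}=\dfrac23$. -/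

import Mathlib

/-- The set of cubes `x ^ 3` of a group. -/
def cubeSet (G : Type*) [Group G] : Set G := {g | ∃ x : G, x ^ 3 = g}

/-- The set of conjugacy classes of a group that are cubes, that is, whose elements are all cubes
(equivalently, at least one element is a cube, the set of cubes being closed under conjugation). -/
def cubeClasses (G : Type*) [Group G] : Set (ConjClasses G) := {C | C.carrier ⊆ cubeSet G}

/-- Sanity check: a class is a cube as soon as one of its elements is. -/
theorem mk_mem_cubeClasses_iff {G : Type*} [Group G] (g : G) :
    ConjClasses.mk g ∈ cubeClasses G ↔ g ∈ cubeSet G := by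
  constructor
  · intro h
    exact h ConjClasses.mem_carrier_mk
  · rintro ⟨x, rfl⟩ a ha
    rw [ConjClasses.mem_carrier_iff_mk_eq, ConjClasses.mk_eq_mk_iff_isConj, isConj_comm,
      isConj_iff] at ha
    obtain ⟨c, rfl⟩ := ha
    exact ⟨c * x * c⁻¹, by simp [conj_pow]⟩

open Matrix

/-! For `x` in `SL₂` with trace `s`, Cayley-Hamilton gives `x³ = (s² - 1)x - s`, of trace `s³ - 3s`.
Solving for `x` shows that `g` is a cube exactly when its trace lies in the image `I` of `s ↦ s³ -
3s` (`mem_cubeSet_iff_trace`), so both counts become counts over `I`.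

Write `χ` for the quadratic character and `η = χ(-3)`, which is `1` exactly when `3 ∣ q - 1`. Off
`s² = 1` the fibre of the cubic through `s` has `2 + η χ(s² - 4)` points. Weighting each `s` by the
inverse fibre size gives `|I| = (2q + η)/3` and `∑_{t ∈ I} χ(t² - 4) = -(2 + ηq)/3`.

There is one class above each trace, except three above each of `±2`. Both lie in `I`, hence `|I| +
4` cube classes out of `q + 4`. There are `q² + q χ(t² - 4)` elements of trace `t`; summed over `I`,
the terms in `η` cancel. -/

theorem natCast_ne_zero_of_prime_not_dvd_card {F : Type*} [Field F] [Finite F] {l : ℕ}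
    (hl : l.Prime) (h : ¬ l ∣ Nat.card F) : (l : F) ≠ 0 := by
  intro h0
  have := Fact.mk hl
  have h1 : addOrderOf (1 : F) = l := addOrderOf_eq_prime (by simpa using h0) one_ne_zero
  exact h (h1 ▸ addOrderOf_dvd_natCard (1 : F))

/-! ### Cubes in `SL₂` and traces. -/

section Cubes

variable {F : Type*} [Field F]

theorem SL2_det_eq (g : SpecialLinearGroup (Fin 2) F) :
    g.1 0 0 * g.1 1 1 - g.1 0 1 * g.1 1 0 = 1 := by
  rw [← Matrix.det_fin_two]; exact g.2

theorem cube_eq_of_det_eq_one {R : Type*} [CommRing R] (M : Matrix (Fin 2) (Fin 2) R)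
    (h : M.det = 1) : M ^ 3 = (M.trace ^ 2 - 1) • M - M.trace • 1 := by
  rw [Matrix.det_fin_two] at h
  ext i j
  fin_cases i <;> fin_cases j <;>
    simp [pow_succ, Matrix.mul_apply, Fin.sum_univ_two, Matrix.trace_fin_two]
  · linear_combination (-2 * M 0 0 - M 1 1) * h
  · linear_combination (-M 0 1) * h
  · linear_combination (-M 1 0) * h
  · linear_combination (-2 * M 1 1 - M 0 0) * h

theorem trace_cube_of_det_eq_one {R : Type*} [CommRing R] (M : Matrix (Fin 2) (Fin 2) R)
    (h : M.det = 1) : (M ^ 3).trace = M.trace ^ 3 - 3 * M.trace := by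
  rw [cube_eq_of_det_eq_one M h]
  simp [Matrix.trace_sub, Matrix.trace_smul]
  ring

/-- In `SL₂` over a field of characteristic not `3`, being a cube is detected by the trace. -/
theorem mem_cubeSet_iff_trace (h3 : (3 : F) ≠ 0) (g : SpecialLinearGroup (Fin 2) F) :
    g ∈ cubeSet (SpecialLinearGroup (Fin 2) F) ↔ ∃ s : F, s ^ 3 - 3 * s = g.1.trace := by
  constructor
  · rintro ⟨x, rfl⟩
    exact ⟨x.1.trace, (trace_cube_of_det_eq_one x.1 x.2).symm.trans
      (congrArg Matrix.trace (Matrix.SpecialLinearGroup.coe_pow x 3).symm)⟩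
  · intro h
    -- If `s² = 1`, then `s` is a double root of `X³ - 3X = tr g`; the remaining root `-2s` has
    -- `(-2s)² - 1 = 3 ≠ 0`.
    obtain ⟨s, hs1, hs⟩ : ∃ s : F, s ^ 2 - 1 ≠ 0 ∧ s ^ 3 - 3 * s = g.1.trace := by
      obtain ⟨s, hs⟩ := h
      by_cases h1 : s ^ 2 - 1 = 0
      · refine ⟨-2 * s, ?_, ?_⟩
        · intro h2
          exact h3 (by linear_combination h2 - 4 * h1)
        · rw [← hs]; linear_combination (-9 * s) * h1
      · exact ⟨s, h1, hs⟩
    have hg := SL2_det_eq g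
    rw [Matrix.trace_fin_two] at hs
    set M : Matrix (Fin 2) (Fin 2) F := (s ^ 2 - 1)⁻¹ • (g.1 + s • 1) with hM
    have htr : M.trace = s := by
      simp [hM, Matrix.trace_fin_two, Matrix.trace_add, Matrix.trace_smul]
      field_simp
      linear_combination -hs
    have hdet : M.det = 1 := by
      rw [hM, Matrix.det_smul, Matrix.det_fin_two]
      simp
      field_simp
      linear_combination hg - s * hs
    refine ⟨⟨M, hdet⟩, Subtype.ext ((Matrix.SpecialLinearGroup.coe_pow _ 3).trans ?_)⟩
    change M ^ 3 = g.1
    rw [cube_eq_of_det_eq_one M hdet, htr, hM, smul_smul, mul_inv_cancel₀ hs1]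
    simp

end Cubes

/-! ### Point counts on conics and elements of given trace. -/

section Counting

variable {F : Type*} [Field F] [Fintype F] [DecidableEq F]

theorem card_monic_quadratic_roots (h2 : ringChar F ≠ 2) (b c : F) :
    (Finset.card {x : F | x ^ 2 + b * x + c = 0} : ℤ) = quadraticChar F (b ^ 2 - 4 * c) + 1 := by
  have h2' : (2 : F) ≠ 0 := Ring.two_ne_zero h2
  rw [← quadraticChar_card_sqrts h2]
  congr 1
  refine Finset.card_bij (fun x _ => 2 * x + b) ?_ ?_ ?_
  · intro x hx
    simp at hx ⊢
    linear_combination 4 * hx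
  · intro x _ y _ h
    exact mul_left_cancel₀ h2' (add_right_cancel h)
  · intro y hy
    simp at hy
    refine ⟨(y - b) / 2, ?_, by field_simp; ring⟩
    simp
    field_simp
    linear_combination hy

theorem card_mul_eq (r : F) :
    (Finset.card {p : F × F | p.1 * p.2 = r} : ℤ) =
      Fintype.card F - 1 + if r = 0 then (Fintype.card F : ℤ) else 0 := by
  have key : (Finset.card {p : F × F | p.1 * p.2 = r} : ℤ) =
      ∑ a : F, (if a = 0 then (if r = 0 then (Fintype.card F : ℤ) else 0) else 1) := by
    rw [Finset.card_filter, Fintype.sum_prod_type]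
    push_cast
    refine Finset.sum_congr rfl fun a _ => ?_
    by_cases ha : a = 0
    · subst ha
      by_cases hr : r = 0 <;> simp [hr, eq_comm]
    · have : ∀ b : F, a * b = r ↔ b = a⁻¹ * r := fun b => by
        rw [eq_inv_mul_iff_mul_eq₀ ha]
      simp [this, ha]
  rw [key, Finset.sum_ite, Finset.filter_eq' Finset.univ (0 : F)]
  simp [Finset.filter_ne', Finset.card_erase_of_mem, Finset.card_univ,
    Nat.cast_sub Fintype.card_pos]
  ring

/-- The conic `y² = s² - 4` is the hyperbola `(s + y)(s - y) = 4`, with `q - 1` points; fibring it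
over `s` counts `∑ (1 + χ(s² - 4))`. -/
theorem sum_quadraticChar_sq_sub_four (h2 : ringChar F ≠ 2) :
    ∑ s : F, quadraticChar F (s ^ 2 - 4) = -1 := by
  have h2' : (2 : F) ≠ 0 := Ring.two_ne_zero h2
  have h4 : (4 : F) ≠ 0 := by
    have : (4 : F) = 2 * 2 := by norm_num
    rw [this]; exact mul_ne_zero h2' h2'
  have h := card_mul_eq (4 : F)
  have e : Finset.card {p : F × F | p.1 * p.2 = 4} =
      Finset.card {p : F × F | p.2 ^ 2 = p.1 ^ 2 - 4} := by
    refine Finset.card_bij (fun p _ => ((p.1 + p.2) / 2, (p.1 - p.2) / 2)) ?_ ?_ ?_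
    · intro p hp
      simp at hp ⊢
      field_simp
      linear_combination (-4) * hp
    · intro p _ p' _ h
      simp only [Prod.mk.injEq] at h
      obtain ⟨ha, hb⟩ := h
      field_simp at ha hb
      ext
      · exact mul_left_cancel₀ h2' (by linear_combination ha + hb)
      · exact mul_left_cancel₀ h2' (by linear_combination ha - hb)
    · rintro ⟨x, y⟩ hp
      simp at hp
      refine ⟨(x + y, x - y), ?_, ?_⟩
      · simp; linear_combination -hp
      · ext <;> simp <;> field_simp <;> ring
  have e2 : (Finset.card {p : F × F | p.2 ^ 2 = p.1 ^ 2 - 4} : ℤ) =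
      ∑ s : F, (quadraticChar F (s ^ 2 - 4) + 1) := by
    rw [Finset.card_filter, Fintype.sum_prod_type]
    push_cast
    refine Finset.sum_congr rfl fun a _ => ?_
    rw [← quadraticChar_card_sqrts h2, Finset.sum_boole]
    simp
  rw [e, e2, Finset.sum_add_distrib, if_neg h4, Finset.sum_const, Finset.card_univ,
    nsmul_one] at h
  linarith

theorem sum_quadraticChar_sq_sub_four_sq (h2 : ringChar F ≠ 2) :
    ∑ s : F, quadraticChar F (s ^ 2 - 4) ^ 2 = Fintype.card F - 2 := by
  have h2' : (2 : F) ≠ 0 := Ring.two_ne_zero h2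
  have hne : (2 : F) ≠ -2 := fun h => by
    have : (2 : F) * 2 = 0 := by linear_combination h
    simp [h2'] at this
  have e : ∀ s : F, quadraticChar F (s ^ 2 - 4) ^ 2 = 1 - if s ∈ ({2, -2} : Finset F) then 1 else 0 := by
    intro s
    have hs : s ∈ ({2, -2} : Finset F) ↔ s ^ 2 - 4 = 0 := by
      rw [show s ^ 2 - 4 = (s - 2) * (s + 2) by ring, mul_eq_zero, sub_eq_zero,
        ← eq_neg_iff_add_eq_zero]
      simp
    by_cases h : s ^ 2 - 4 = 0
    · rw [if_pos (hs.2 h), h]; simp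
    · rw [if_neg (fun h' => h (hs.1 h')), quadraticChar_sq_one h]; simp
  rw [Finset.sum_congr rfl fun s _ => e s, Finset.sum_sub_distrib, Finset.sum_ite_mem]
  simp [Finset.card_pair hne]

/-- With upper left entry `a`, the off-diagonal entries have product `a(t - a) - 1`. This gives `q -
1` choices, and `q` more when `a` is a root of `X² - tX + 1`, whose discriminant is `t² - 4`. -/
theorem card_SL2_trace_eq (h2 : ringChar F ≠ 2) (t : F) :
    (Nat.card {g : SpecialLinearGroup (Fin 2) F // g.1.trace = t} : ℤ) =
      (Fintype.card F : ℤ) ^ 2 + Fintype.card F * quadraticChar F (t ^ 2 - 4) := by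
  have e : {g : SpecialLinearGroup (Fin 2) F // g.1.trace = t} ≃
      (Finset.univ.filter fun p : F × F × F => p.2.1 * p.2.2 = p.1 * (t - p.1) - 1) :=
    { toFun := fun g => ⟨(g.1.1 0 0, g.1.1 0 1, g.1.1 1 0), by
        have := SL2_det_eq g.1
        have ht := g.2
        rw [Matrix.trace_fin_two] at ht
        simp
        linear_combination -this + g.1.1 0 0 * ht⟩
      invFun := fun p => ⟨⟨!![p.1.1, p.1.2.1; p.1.2.2, t - p.1.1], by
        have := (Finset.mem_filter.1 p.2).2
        rw [Matrix.det_fin_two]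
        simp
        linear_combination -this⟩, by simp [Matrix.trace_fin_two]⟩
      left_inv := fun g => by
        have ht := g.2
        rw [Matrix.trace_fin_two] at ht
        ext i j
        fin_cases i <;> fin_cases j <;> simp
        linear_combination -ht
      right_inv := fun p => by
        ext <;> simp }
  rw [Nat.card_congr e, Nat.card_eq_fintype_card, Fintype.card_coe, Finset.card_filter,
    Fintype.sum_prod_type]
  have key : ∀ a : F, ((∑ p : F × F, if p.1 * p.2 = a * (t - a) - 1 then 1 else 0 : ℕ) : ℤ) =
      Fintype.card F - 1 + Fintype.card F * if a ^ 2 + (-t) * a + 1 = 0 then 1 else 0 := by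
    intro a
    rw [← Finset.card_filter, card_mul_eq]
    have : a * (t - a) - 1 = 0 ↔ a ^ 2 + (-t) * a + 1 = 0 := by
      constructor <;> intro h <;> linear_combination -h
    simp [this]
  rw [Nat.cast_sum, Finset.sum_congr rfl fun a _ => key a, Finset.sum_add_distrib,
    ← Finset.mul_sum, Finset.sum_boole, card_monic_quadratic_roots h2]
  simp
  ring

end Counting

/-! ### The image of `s ↦ s³ - 3s`. -/

section CubicImage

variable {F : Type*} [Field F] [Fintype F] [DecidableEq F]

/-- Dividing out `r - s` leaves a quadratic in `r` of discriminant `-3(s² - 4)`, which has `s` as a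
root only if `s² = 1`. -/
theorem card_fiber_cubic_of_sq_ne_one (h2 : ringChar F ≠ 2) (h3 : (3 : F) ≠ 0) {s : F}
    (hs : s ^ 2 ≠ 1) :
    (Finset.card {r : F | r ^ 3 - 3 * r = s ^ 3 - 3 * s} : ℤ) =
      2 + quadraticChar F (-3) * quadraticChar F (s ^ 2 - 4) := by
  have e : ({r : F | r ^ 3 - 3 * r = s ^ 3 - 3 * s} : Finset F) =
      insert s ({r : F | r ^ 2 + s * r + (s ^ 2 - 3) = 0} : Finset F) := by
    ext r
    simp only [Finset.mem_filter, Finset.mem_univ, true_and, Finset.mem_insert]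
    rw [← sub_eq_zero, show r ^ 3 - 3 * r - (s ^ 3 - 3 * s) =
      (r - s) * (r ^ 2 + s * r + (s ^ 2 - 3)) by ring, mul_eq_zero, sub_eq_zero]
  rw [e, Finset.card_insert_of_notMem, Nat.cast_add, card_monic_quadratic_roots h2, ← map_mul,
    show s ^ 2 - 4 * (s ^ 2 - 3) = -3 * (s ^ 2 - 4) by ring]
  · push_cast; ring
  · simp only [Finset.mem_filter, Finset.mem_univ, true_and]
    intro h
    have : (3 : F) * (s ^ 2 - 1) = 0 := by linear_combination h
    exact hs (sub_eq_zero.1 ((mul_eq_zero.1 this).resolve_left h3))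

theorem card_fiber_cubic_of_sq_eq_one (h3 : (3 : F) ≠ 0) {s : F} (hs : s ^ 2 = 1) :
    Finset.card {r : F | r ^ 3 - 3 * r = s ^ 3 - 3 * s} = 2 := by
  have e : ({r : F | r ^ 3 - 3 * r = s ^ 3 - 3 * s} : Finset F) = {s, -2 * s} := by
    ext r
    simp only [Finset.mem_filter, Finset.mem_univ, true_and, Finset.mem_insert,
      Finset.mem_singleton]
    rw [← sub_eq_zero, show r ^ 3 - 3 * r - (s ^ 3 - 3 * s) =
      (r - s) * ((r - s) * (r - -2 * s)) by linear_combination (3 * r - 3 * s) * hs,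
      mul_eq_zero, mul_eq_zero, sub_eq_zero, sub_eq_zero]
    tauto
  rw [e, Finset.card_pair]
  intro h
  have h0 : (3 : F) * s = 0 := by linear_combination h
  have := (mul_eq_zero.1 h0).resolve_left h3
  simp [this] at hs

theorem sum_image_eq_sum_div_card_fiber {α β : Type*} [Fintype α] [DecidableEq β] (D : α → β)
    (f : β → ℚ) : ∑ t ∈ Finset.univ.image D, f t =
      ∑ s, f (D s) * ((Finset.card {r : α | D r = D s} : ℕ) : ℚ)⁻¹ := by
  refine Finset.sum_image' _ fun i _ => ?_
  rw [Finset.sum_congr rfl (g := fun _ => f (D i) * ((Finset.card {r : α | D r = D i} : ℕ) : ℚ)⁻¹)]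
  · rw [Finset.sum_const, nsmul_eq_mul]
    have : ((Finset.card {r : α | D r = D i} : ℕ) : ℚ) ≠ 0 := by
      rw [Nat.cast_ne_zero, ← Nat.pos_iff_ne_zero, Finset.card_pos]
      exact ⟨i, by simp⟩
    field_simp
  · intro j hj
    rw [(Finset.mem_filter.1 hj).2]

theorem quadraticChar_cast_cases {a : F} (x : ℚ) (hx : x = quadraticChar F a) :
    x = 0 ∨ x = 1 ∨ x = -1 := by
  subst hx
  by_cases h : a = 0
  · simp [h]
  · rcases quadraticChar_dichotomy h with h | h <;> rw [h] <;> simp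

/-- For `ε ∈ {0, 1, -1}`, `1/(2 + ε) = 1/2 - ε/3 + ε²/6`, applied to `ε = η χ(s² - 4)`. At `s² = 1`
one has `ε = η² = 1`, and the last term corrects `1/3` to `1/2`. The result is linear in character
sums already known. -/
theorem inv_card_fiber_cubic (h2 : ringChar F ≠ 2) (h3 : (3 : F) ≠ 0) (s : F) :
    ((Finset.card {r : F | r ^ 3 - 3 * r = s ^ 3 - 3 * s} : ℕ) : ℚ)⁻¹ =
      1 / 2 - (quadraticChar F (-3) : ℚ) * quadraticChar F (s ^ 2 - 4) / 3 +
        (quadraticChar F (s ^ 2 - 4) : ℚ) ^ 2 / 6 + (if s ^ 2 = 1 then 1 else 0) / 6 := by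
  have h3' : (-3 : F) ≠ 0 := neg_ne_zero.2 h3
  by_cases hs : s ^ 2 = 1
  · rw [card_fiber_cubic_of_sq_eq_one h3 hs, if_pos hs, hs, show (1 : F) - 4 = -3 by norm_num]
    rcases quadraticChar_dichotomy h3' with h | h <;> rw [h] <;> norm_num
  · have h := card_fiber_cubic_of_sq_ne_one h2 h3 hs
    have h' : ((Finset.card {r : F | r ^ 3 - 3 * r = s ^ 3 - 3 * s} : ℕ) : ℚ) =
        2 + (quadraticChar F (-3) : ℚ) * quadraticChar F (s ^ 2 - 4) := by exact_mod_cast h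
    rw [h', if_neg hs]
    rcases quadraticChar_dichotomy h3' with h | h <;> rw [h] <;>
    rcases quadraticChar_cast_cases _ (rfl : _ = (quadraticChar F (s ^ 2 - 4) : ℚ))
      with h | h | h <;> rw [h] <;> norm_num

theorem card_sq_eq_one (h2 : ringChar F ≠ 2) : Finset.card {s : F | s ^ 2 = 1} = 2 := by
  have := quadraticChar_card_sqrts h2 (1 : F)
  rw [map_one] at this
  have e : ({s : F | s ^ 2 = 1} : Set F).toFinset = ({s : F | s ^ 2 = 1} : Finset F) := by
    ext; simp
  rw [e] at this
  exact_mod_cast this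

theorem card_image_cubic (h2 : ringChar F ≠ 2) (h3 : (3 : F) ≠ 0) :
    ((Finset.univ.image fun s : F => s ^ 3 - 3 * s).card : ℚ) =
      (2 * Fintype.card F + quadraticChar F (-3)) / 3 := by
  have h := sum_image_eq_sum_div_card_fiber (fun s : F => s ^ 3 - 3 * s) fun _ => 1
  have s1 : ∑ s : F, (quadraticChar F (s ^ 2 - 4) : ℚ) = -1 := by
    exact_mod_cast sum_quadraticChar_sq_sub_four h2
  have s2 : ∑ s : F, (quadraticChar F (s ^ 2 - 4) : ℚ) ^ 2 = Fintype.card F - 2 := by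
    exact_mod_cast sum_quadraticChar_sq_sub_four_sq h2
  have s3 : ∑ s : F, (if s ^ 2 = 1 then (1 : ℚ) else 0) = 2 := by
    rw [Finset.sum_boole, card_sq_eq_one h2]; rfl
  simp only [inv_card_fiber_cubic h2 h3, one_mul] at h
  rw [Finset.sum_const, nsmul_one, Finset.sum_add_distrib, Finset.sum_add_distrib,
    Finset.sum_sub_distrib, ← Finset.sum_div, ← Finset.sum_div, ← Finset.sum_div,
    ← Finset.sum_div, ← Finset.mul_sum, s1, s2, s3, Finset.sum_const, Finset.card_univ, nsmul_eq_mul] at h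
  rw [h]; ring

theorem sum_image_cubic_quadraticChar (h2 : ringChar F ≠ 2) (h3 : (3 : F) ≠ 0) :
    ∑ t ∈ Finset.univ.image (fun s : F => s ^ 3 - 3 * s), (quadraticChar F (t ^ 2 - 4) : ℚ) =
      -(2 + quadraticChar F (-3) * Fintype.card F) / 3 := by
  have h3' : (-3 : F) ≠ 0 := neg_ne_zero.2 h3
  have s1 : ∑ s : F, (quadraticChar F (s ^ 2 - 4) : ℚ) = -1 := by
    exact_mod_cast sum_quadraticChar_sq_sub_four h2
  have s2 : ∑ s : F, (quadraticChar F (s ^ 2 - 4) : ℚ) ^ 2 = Fintype.card F - 2 := by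
    exact_mod_cast sum_quadraticChar_sq_sub_four_sq h2
  have s3 : ∑ s : F, (if s ^ 2 = 1 then (1 : ℚ) else 0) = 2 := by
    rw [Finset.sum_boole, card_sq_eq_one h2]; rfl
  have pt : ∀ s : F, (quadraticChar F ((s ^ 3 - 3 * s) ^ 2 - 4) : ℚ) *
      ((Finset.card {r : F | r ^ 3 - 3 * r = s ^ 3 - 3 * s} : ℕ) : ℚ)⁻¹ =
      (2 / 3 : ℚ) * quadraticChar F (s ^ 2 - 4) -
        (quadraticChar F (-3) : ℚ) / 3 * (quadraticChar F (s ^ 2 - 4) : ℚ) ^ 2 -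
        (quadraticChar F (-3) : ℚ) / 3 * (if s ^ 2 = 1 then 1 else 0) := by
    intro s
    -- Up to the square `(s² - 1)²`, `t² - 4` is `s² - 4`, so `χ` is unchanged unless `s² = 1`.
    rw [inv_card_fiber_cubic h2 h3, show (s ^ 3 - 3 * s) ^ 2 - 4 =
      (s ^ 2 - 1) ^ 2 * (s ^ 2 - 4) by ring]
    by_cases hs : s ^ 2 = 1
    · rw [if_pos hs, hs, show (1 : F) - 4 = -3 by norm_num]
      rcases quadraticChar_dichotomy h3' with h | h <;> rw [h] <;> norm_num
    · rw [if_neg hs, map_mul, quadraticChar_sq_one' (sub_ne_zero.2 hs), one_mul]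
      rcases quadraticChar_dichotomy h3' with h | h <;> rw [h] <;>
      rcases quadraticChar_cast_cases _ (rfl : _ = (quadraticChar F (s ^ 2 - 4) : ℚ))
        with h | h | h <;> rw [h] <;> norm_num
  rw [sum_image_eq_sum_div_card_fiber (fun s : F => s ^ 3 - 3 * s)
    fun t => (quadraticChar F (t ^ 2 - 4) : ℚ), Finset.sum_congr rfl fun s _ => pt s,
    Finset.sum_sub_distrib, Finset.sum_sub_distrib, ← Finset.mul_sum, ← Finset.mul_sum,
    ← Finset.mul_sum, s1, s2, s3]
  ring

theorem quadraticChar_neg_three_eq_one (h : 3 ∣ Fintype.card F - 1) : quadraticChar F (-3) = 1 := by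
  have h3 : (3 : F) ≠ 0 := by
    intro h0
    have hd := addOrderOf_dvd_card (x := (1 : F))
    have := Fact.mk Nat.prime_three
    rw [addOrderOf_eq_prime (p := 3) (by simpa using h0) one_ne_zero] at hd
    have := Fintype.card_pos (α := F)
    omega
  rw [← Fintype.card_units] at h
  have := Fact.mk Nat.prime_three
  obtain ⟨w, hw⟩ := exists_prime_orderOf_dvd_card 3 h
  have hw3 : (w : F) ^ 3 = 1 := by
    rw [← Units.val_pow_eq_pow_val, ← hw, pow_orderOf_eq_one, Units.val_one]
  have hw1 : (w : F) - 1 ≠ 0 := by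
    intro h1
    have : w = 1 := Units.ext (sub_eq_zero.1 h1)
    simp [this] at hw
  have hq : (w : F) ^ 2 + w + 1 = 0 := by
    have : ((w : F) - 1) * ((w : F) ^ 2 + w + 1) = 0 := by linear_combination hw3
    exact (mul_eq_zero.1 this).resolve_left hw1
  rw [quadraticChar_one_iff_isSquare (neg_ne_zero.2 h3)]
  -- A primitive cube root of unity `w` satisfies `(2w + 1)² = -3`; the converse inverts this by `w
  -- = (y - 1)/2`.
  exact ⟨2 * w + 1, by linear_combination (-4) * hq⟩

theorem three_dvd_card_sub_one (h2 : ringChar F ≠ 2) (h3 : (3 : F) ≠ 0)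
    (h : quadraticChar F (-3) = 1) : 3 ∣ Fintype.card F - 1 := by
  rw [quadraticChar_one_iff_isSquare (neg_ne_zero.2 h3)] at h
  obtain ⟨y, hy⟩ := h
  have h2' : (2 : F) ≠ 0 := Ring.two_ne_zero h2
  have hw3 : ((y - 1) / 2) ^ 3 = 1 := by
    field_simp
    linear_combination (3 - y) * hy
  have hw0 : (y - 1) / 2 ≠ 0 := by
    intro h0
    simp [h0] at hw3
  have hw1 : Units.mk0 _ hw0 ≠ 1 := by
    intro h1
    have : (y - 1) / 2 = 1 := congrArg Units.val h1
    field_simp at this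
    have hy3 : y = 3 := by linear_combination this
    rw [hy3] at hy
    have : (2 : F) * 2 * 3 = 0 := by linear_combination -hy
    simp [h2', h3] at this
  have := Fact.mk Nat.prime_three
  have ho := orderOf_eq_prime (p := 3) (Units.ext (by simpa using hw3)) hw1
  rw [← Fintype.card_units, ← ho]
  exact orderOf_dvd_card

end CubicImage

/-! ### Conjugacy classes of `SL₂` via the binary form `v ∧ gv`. -/

section Classes

variable {F : Type*} [Field F]

/-- The determinant of the matrix with columns `v` and `w`. -/
def wedge (v w : Fin 2 → F) : F := v 0 * w 1 - v 1 * w 0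

theorem wedge_mulVec (P : Matrix (Fin 2) (Fin 2) F) (v w : Fin 2 → F) :
    wedge (P *ᵥ v) (P *ᵥ w) = P.det * wedge v w := by
  simp [wedge, Matrix.mulVec, dotProduct, Fin.sum_univ_two, Matrix.det_fin_two]
  ring

/-- The values of the binary quadratic form `v ↦ v ∧ g v`. -/
def repValues (g : SpecialLinearGroup (Fin 2) F) : Set F :=
  {k | ∃ v : Fin 2 → F, wedge v (g.1 *ᵥ v) = k}

theorem mem_repValues {g : SpecialLinearGroup (Fin 2) F} {k : F} :
    k ∈ repValues g ↔
      ∃ x y : F, g.1 1 0 * x ^ 2 + (g.1 1 1 - g.1 0 0) * (x * y) - g.1 0 1 * y ^ 2 = k := by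
  constructor
  · rintro ⟨v, rfl⟩
    refine ⟨v 0, v 1, ?_⟩
    simp [wedge, Matrix.mulVec, dotProduct, Fin.sum_univ_two]
    ring
  · rintro ⟨x, y, rfl⟩
    refine ⟨![x, y], ?_⟩
    simp [wedge, Matrix.mulVec, dotProduct, Fin.sum_univ_two]
    ring

theorem sq_mul_mem_repValues {g : SpecialLinearGroup (Fin 2) F} {k : F} (m : F)
    (h : k ∈ repValues g) : m ^ 2 * k ∈ repValues g := by
  rw [mem_repValues] at h ⊢
  obtain ⟨x, y, rfl⟩ := h
  exact ⟨m * x, m * y, by ring⟩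

theorem repValues_subset_of_isConj {g h : SpecialLinearGroup (Fin 2) F} (hc : IsConj g h) :
    repValues g ⊆ repValues h := by
  obtain ⟨P, rfl⟩ := isConj_iff.1 hc
  rintro _ ⟨v, rfl⟩
  refine ⟨P.1 *ᵥ v, ?_⟩
  have e : (P * g * P⁻¹).1 *ᵥ (P.1 *ᵥ v) = P.1 *ᵥ (g.1 *ᵥ v) := by
    rw [Matrix.mulVec_mulVec, Matrix.mulVec_mulVec]
    congr 1
    exact congrArg Subtype.val (show P * g * P⁻¹ * P = P * g by group)
  rw [e, wedge_mulVec, P.2, one_mul]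

theorem repValues_eq_of_isConj {g h : SpecialLinearGroup (Fin 2) F} (hc : IsConj g h) :
    repValues g = repValues h :=
  (repValues_subset_of_isConj hc).antisymm (repValues_subset_of_isConj hc.symm)

theorem trace_eq_of_isConj {g h : SpecialLinearGroup (Fin 2) F} (hc : IsConj g h) :
    g.1.trace = h.1.trace := by
  obtain ⟨P, rfl⟩ := isConj_iff.1 hc
  change g.1.trace = (P.1 * g.1 * (P⁻¹).1).trace
  rw [Matrix.trace_mul_comm, ← Matrix.mul_assoc]
  congr 1
  exact congrArg Subtype.val (show g = P⁻¹ * P * g by group)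

/-- The companion matrix of `X² - tX + 1`. -/
def companionSL (t : F) : SpecialLinearGroup (Fin 2) F :=
  ⟨!![0, -1; 1, t], by simp [Matrix.det_fin_two]⟩

/-- The lower triangular matrix with diagonal `(e, e)`, where `e² = 1`. -/
def lowerSL (e k : F) (he : e ^ 2 = 1) : SpecialLinearGroup (Fin 2) F :=
  ⟨!![e, 0; k, e], by simp [Matrix.det_fin_two, ← he, sq]⟩

theorem trace_companionSL (t : F) : (companionSL t).1.trace = t := by
  simp [companionSL, Matrix.trace_fin_two]

theorem trace_lowerSL (e k : F) (he : e ^ 2 = 1) : (lowerSL e k he).1.trace = 2 * e := by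
  simp [lowerSL, Matrix.trace_fin_two, two_mul]

theorem one_mem_repValues_companionSL (t : F) : 1 ∈ repValues (companionSL t) :=
  mem_repValues.2 ⟨1, 0, by simp [companionSL]⟩

theorem mem_repValues_lowerSL {e k : F} (he : e ^ 2 = 1) {r : F} :
    r ∈ repValues (lowerSL e k he) ↔ ∃ x, k * x ^ 2 = r := by
  rw [mem_repValues]
  simp [lowerSL]

theorem isConj_of_mul_eq {g h P : SpecialLinearGroup (Fin 2) F} (e : P.1 * g.1 = h.1 * P.1) :
    IsConj g h :=
  isConj_iff.2 ⟨P, mul_inv_eq_iff_eq_mul.2 (Subtype.ext e)⟩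

/-- If `v ∧ gv = 1`, the basis `(v, gv)` has determinant `1`, and in it `g` is its companion matrix.
-/
theorem isConj_companionSL {g : SpecialLinearGroup (Fin 2) F} (h : 1 ∈ repValues g) :
    IsConj (companionSL g.1.trace) g := by
  obtain ⟨x, y, h⟩ := mem_repValues.1 h
  have hg := SL2_det_eq g
  refine isConj_of_mul_eq (P := ⟨!![x, g.1 0 0 * x + g.1 0 1 * y;
    y, g.1 1 0 * x + g.1 1 1 * y], ?_⟩) ?_
  · rw [Matrix.det_fin_two]
    simp
    linear_combination h
  · ext i j
    fin_cases i <;> fin_cases j <;>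
      simp [companionSL, Matrix.mul_apply, Fin.sum_univ_two, Matrix.trace_fin_two]
    · linear_combination x * hg
    · linear_combination y * hg

/-- Here `(g - e)² = 0`. If `v ∧ gv = k`, the basis `(v, (gv - ev)/k)` has determinant `1` and puts
`g` in triangular form. -/
theorem isConj_lowerSL {g : SpecialLinearGroup (Fin 2) F} {e k : F} (he : e ^ 2 = 1)
    (ht : g.1.trace = 2 * e) (hk : k ≠ 0) (h : k ∈ repValues g) :
    IsConj (lowerSL e k he) g := by
  obtain ⟨x, y, h⟩ := mem_repValues.1 h
  have hg := SL2_det_eq g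
  rw [Matrix.trace_fin_two] at ht
  refine isConj_of_mul_eq (P := ⟨!![x, (g.1 0 0 * x + g.1 0 1 * y - e * x) / k;
    y, (g.1 1 0 * x + g.1 1 1 * y - e * y) / k], ?_⟩) ?_
  · rw [Matrix.det_fin_two]
    simp
    field_simp
    linear_combination h
  · ext i j
    fin_cases i <;> fin_cases j <;>
      simp [lowerSL, Matrix.mul_apply, Fin.sum_univ_two] <;> field_simp
    · ring
    · linear_combination x * hg - (g.1 0 0 * x + g.1 0 1 * y) * ht - x * he
    · ring
    · linear_combination y * hg - (g.1 1 0 * x + g.1 1 1 * y) * ht - y * he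

variable [Fintype F]

/-- The form has discriminant `tr(g)² - 4`, and a nondegenerate binary form over a finite field of
odd characteristic represents every nonzero value. -/
theorem one_mem_repValues_of_trace_sq_ne (h2 : ringChar F ≠ 2)
    {g : SpecialLinearGroup (Fin 2) F} (ht : g.1.trace ^ 2 ≠ 4) : 1 ∈ repValues g := by
  have h2' : (2 : F) ≠ 0 := Ring.two_ne_zero h2
  have hg := SL2_det_eq g
  rw [Matrix.trace_fin_two] at ht
  rw [mem_repValues]
  generalize g.1 0 0 = a at *
  generalize g.1 0 1 = b at *
  generalize g.1 1 0 = c at *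
  generalize g.1 1 1 = d at *
  by_cases hc : c = 0
  · subst hc
    have hda : d - a ≠ 0 := fun h0 => ht (by linear_combination 4 * hg + (d - a) * h0)
    exact ⟨(1 + b) / (d - a), 1, by field_simp; ring⟩
  · have hD : (a + d) ^ 2 - 4 ≠ 0 := sub_ne_zero.2 ht
    have hq : -((a + d) ^ 2 - 4) / (2 * 2 * c) ≠ 0 :=
      div_ne_zero (neg_ne_zero.2 hD) (by simp [h2', hc])
    obtain ⟨X, Y, hXY⟩ := FiniteField.exists_root_sum_quadratic
      (f := Polynomial.C c * Polynomial.X ^ 2 + Polynomial.C 0 * Polynomial.X + Polynomial.C (-1))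
      (g := Polynomial.C (-((a + d) ^ 2 - 4) / (2 * 2 * c)) * Polynomial.X ^ 2 +
        Polynomial.C 0 * Polynomial.X + Polynomial.C 0)
      (Polynomial.degree_quadratic hc) (Polynomial.degree_quadratic hq)
      (FiniteField.odd_card_of_char_ne_two h2)
    simp at hXY
    -- This undoes the completion of the square that diagonalised the form.
    refine ⟨X - (d - a) / (2 * c) * Y, Y, ?_⟩
    field_simp at hXY ⊢
    linear_combination hXY + 4 * Y ^ 2 * hg

/-- Unless `g` is scalar, an off-diagonal entry gives a nonzero value of the form. Values can be
scaled by squares, and there are only two nonzero square classes, those of `1` and `r`. -/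
theorem eq_lowerSL_or_mem_repValues (h2 : ringChar F ≠ 2)
    {g : SpecialLinearGroup (Fin 2) F} {e r : F} (he : e ^ 2 = 1) (ht : g.1.trace = 2 * e)
    (hr : ¬ IsSquare r) : g = lowerSL e 0 he ∨ 1 ∈ repValues g ∨ r ∈ repValues g := by
  classical
  have h2' : (2 : F) ≠ 0 := Ring.two_ne_zero h2
  have hg := SL2_det_eq g
  rw [Matrix.trace_fin_two] at ht
  have hr0 : r ≠ 0 := fun h => hr (by simp [h])
  have of_mem : ∀ k, k ≠ 0 → k ∈ repValues g → 1 ∈ repValues g ∨ r ∈ repValues g := by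
    intro k hk hkg
    by_cases hs : IsSquare k
    · left
      obtain ⟨m, rfl⟩ := hs
      have := sq_mul_mem_repValues m⁻¹ hkg
      have hm : m ≠ 0 := fun h => hk (by simp [h])
      rwa [show m⁻¹ ^ 2 * (m * m) = 1 by field_simp] at this
    · right
      have h1 : quadraticChar F (r * k) = 1 := by
        rw [map_mul, quadraticChar_neg_one_iff_not_isSquare.2 hr,
          quadraticChar_neg_one_iff_not_isSquare.2 hs]; norm_num
      obtain ⟨m, hm⟩ := (quadraticChar_one_iff_isSquare (mul_ne_zero hr0 hk)).1 h1
      have := sq_mul_mem_repValues (m / k) hkg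
      rwa [show (m / k) ^ 2 * k = r by field_simp; linear_combination -hm] at this
  by_cases hc : g.1 1 0 = 0
  · by_cases hb : g.1 0 1 = 0
    · left
      have h0 : (g.1 0 0 - g.1 1 1) ^ 2 = 0 := by
        rw [hc, hb] at hg
        linear_combination (g.1 0 0 + g.1 1 1 + 2 * e) * ht - 4 * hg + 4 * he
      have h1 := sub_eq_zero.1 (pow_eq_zero_iff two_ne_zero |>.1 h0)
      have h2 : g.1 1 1 = e := mul_left_cancel₀ h2' (by linear_combination ht - h1)
      ext i j
      fin_cases i <;> fin_cases j <;> simp [lowerSL]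
      exacts [h1.trans h2, hb, hc, h2]
    · exact .inr (of_mem _ (neg_ne_zero.2 hb) (mem_repValues.2 ⟨0, 1, by ring⟩))
  · exact .inr (of_mem _ hc (mem_repValues.2 ⟨1, 0, by ring⟩))

/-- Above every trace other than `±2` there is one conjugacy class of `SL₂`, and above each of
`±2` there are three. -/
theorem ncard_conjClasses_trace_mem (h2 : ringChar F ≠ 2) (S : Finset F) (hS : 2 ∈ S)
    (hS' : -2 ∈ S) :
    (ConjClasses.mk '' {g : SpecialLinearGroup (Fin 2) F | g.1.trace ∈ S}).ncard =
      S.card + 4 := by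
  classical
  have h2' : (2 : F) ≠ 0 := Ring.two_ne_zero h2
  obtain ⟨r, hr⟩ := FiniteField.exists_nonsquare h2
  have hr0 : r ≠ 0 := fun h => hr (by simp [h])
  let e : Bool → F := fun b => if b then 1 else -1
  have he : ∀ b, e b ^ 2 = 1 := by intro b; cases b <;> simp [e]
  have e_inj : Function.Injective e := by
    have h : (1 : F) ≠ -1 := fun h => h2' (by linear_combination h)
    intro a b hab
    cases a <;> cases b <;> simp_all [e, eq_comm]
  let κ : Bool → F := fun b => if b then r else 0
  let ρ : F → ConjClasses (SpecialLinearGroup (Fin 2) F) := fun t => .mk (companionSL t)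
  let σ : Bool × Bool → ConjClasses (SpecialLinearGroup (Fin 2) F) :=
    fun p => .mk (lowerSL (e p.1) (κ p.2) (he p.1))
  have hρ : Function.Injective ρ := fun t u h => by
    have := trace_eq_of_isConj (ConjClasses.mk_eq_mk_iff_isConj.1 h)
    rwa [trace_companionSL, trace_companionSL] at this
  have hσ : Function.Injective σ := by
    rintro ⟨a, b⟩ ⟨a', b'⟩ h
    have hc := ConjClasses.mk_eq_mk_iff_isConj.1 h
    have ht := trace_eq_of_isConj hc
    rw [trace_lowerSL, trace_lowerSL] at ht
    have hR := Set.ext_iff.1 (repValues_eq_of_isConj hc) r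
    rw [mem_repValues_lowerSL, mem_repValues_lowerSL] at hR
    have hκ : ∀ b, (∃ x, κ b * x ^ 2 = r) ↔ b = true := by
      intro b
      cases b
      · simp [κ, hr0.symm]
      · simpa [κ] using ⟨1, by simp⟩
    rw [hκ, hκ] at hR
    exact Prod.ext (e_inj (mul_left_cancel₀ h2' ht)) (Bool.eq_iff_iff.2 hR)
  -- Companion matrices represent `1`; the triangular ones represent only `0`, or only `r` times
  -- squares.
  have hdisj : Disjoint (ρ '' S) (Set.range σ) := by
    rw [Set.disjoint_left]
    rintro _ ⟨t, _, rfl⟩ ⟨p, hp⟩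
    have hR := repValues_eq_of_isConj (ConjClasses.mk_eq_mk_iff_isConj.1 hp)
    have h1 := one_mem_repValues_companionSL t
    rw [← hR, mem_repValues_lowerSL] at h1
    obtain ⟨x, hx⟩ := h1
    rcases p with ⟨a, _ | _⟩
    · simp [κ] at hx
    · refine hr ⟨x⁻¹, ?_⟩
      have hx0 : x ≠ 0 := fun h => by simp [h] at hx
      simp only [κ, if_true] at hx
      field_simp
      exact hx
  have hunion : ConjClasses.mk '' {g : SpecialLinearGroup (Fin 2) F | g.1.trace ∈ S} =
      ρ '' S ∪ Set.range σ := by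
    ext C
    constructor
    · rintro ⟨g, hg, rfl⟩
      have of_one : 1 ∈ repValues g → ConjClasses.mk g ∈ ρ '' S ∪ Set.range σ := fun h =>
        .inl ⟨_, hg, ConjClasses.mk_eq_mk_iff_isConj.2 (isConj_companionSL h)⟩
      by_cases ht : g.1.trace ^ 2 = 4
      · obtain ⟨b, hb⟩ : ∃ b, g.1.trace = 2 * e b := by
          have : (g.1.trace - 2) * (g.1.trace + 2) = 0 := by linear_combination ht
          rcases mul_eq_zero.1 this with h | h
          · exact ⟨true, by simp only [e, if_true]; linear_combination h⟩
          · exact ⟨false, by simp [e]; linear_combination h⟩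
        rcases eq_lowerSL_or_mem_repValues h2 (he b) hb hr with h | h | h
        · exact .inr ⟨(b, false), by rw [h]; rfl⟩
        · exact of_one h
        · exact .inr ⟨(b, true),
            ConjClasses.mk_eq_mk_iff_isConj.2 (isConj_lowerSL (he b) hb hr0 h)⟩
      · exact of_one (one_mem_repValues_of_trace_sq_ne h2 ht)
    · rintro (⟨t, ht, rfl⟩ | ⟨⟨a, b⟩, rfl⟩)
      · exact ⟨_, by rw [Set.mem_ofPred_eq, trace_companionSL]; exact ht, rfl⟩
      · refine ⟨_, ?_, rfl⟩
        rw [Set.mem_ofPred_eq, trace_lowerSL]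
        cases a <;> simpa [e]
  rw [hunion, Set.ncard_union_eq hdisj (Set.toFinite _) (Set.toFinite _),
    Set.ncard_image_of_injective _ hρ, Set.ncard_coe_finset, ← Set.image_univ,
    Set.ncard_image_of_injective _ hσ, Set.ncard_univ]
  simp

end Classes

/-! ### The group order, the class number and the cube counts. -/

section Main

variable {F : Type*} [Field F] [Fintype F]

theorem natCard_SL2 (h2 : ringChar F ≠ 2) :
    (Nat.card (SpecialLinearGroup (Fin 2) F) : ℤ) =
      (Fintype.card F : ℤ) ^ 3 - Fintype.card F := by
  classical
  rw [Nat.card_congr (Equiv.sigmaFiberEquiv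
    fun g : SpecialLinearGroup (Fin 2) F => g.1.trace).symm, Nat.card_sigma]
  push_cast
  rw [Finset.sum_congr rfl fun t _ => card_SL2_trace_eq h2 t, Finset.sum_add_distrib,
    ← Finset.mul_sum, sum_quadraticChar_sq_sub_four h2]
  simp
  ring

theorem natCard_conjClasses_SL2 (h2 : ringChar F ≠ 2) :
    Nat.card (ConjClasses (SpecialLinearGroup (Fin 2) F)) = Fintype.card F + 4 := by
  have h := ncard_conjClasses_trace_mem h2 (Finset.univ : Finset F) (by simp) (by simp)
  rw [Finset.card_univ] at h
  rw [← h, ← Set.ncard_univ]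
  congr 1
  ext C
  obtain ⟨g, rfl⟩ := ConjClasses.mk_surjective C
  simp

theorem ncard_cubeClasses_SL2 [DecidableEq F] (h2 : ringChar F ≠ 2) (h3 : (3 : F) ≠ 0) :
    ((cubeClasses (SpecialLinearGroup (Fin 2) F)).ncard : ℚ) =
      (2 * Fintype.card F + quadraticChar F (-3)) / 3 + 4 := by
  have e : cubeClasses (SpecialLinearGroup (Fin 2) F) = ConjClasses.mk ''
      {g | g.1.trace ∈ Finset.univ.image fun s : F => s ^ 3 - 3 * s} := by
    ext C
    obtain ⟨g, rfl⟩ := ConjClasses.mk_surjective C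
    rw [mk_mem_cubeClasses_iff, mem_cubeSet_iff_trace h3]
    constructor
    · intro h
      exact ⟨g, by simpa using h, rfl⟩
    · rintro ⟨g', hg', h⟩
      rw [Set.mem_ofPred_eq, trace_eq_of_isConj (ConjClasses.mk_eq_mk_iff_isConj.1 h)] at hg'
      simpa using hg'
  rw [e, ncard_conjClasses_trace_mem h2, Nat.cast_add, card_image_cubic h2 h3]
  · norm_num
  · simpa using ⟨2, by norm_num⟩
  · simpa using ⟨-2, by norm_num⟩

theorem ncard_cubeSet_SL2 (h2 : ringChar F ≠ 2) (h3 : (3 : F) ≠ 0) :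
    ((cubeSet (SpecialLinearGroup (Fin 2) F)).ncard : ℚ) =
      2 * Fintype.card F * ((Fintype.card F : ℚ) ^ 2 - 1) / 3 := by
  classical
  set I := Finset.univ.image fun s : F => s ^ 3 - 3 * s with hI
  have e : cubeSet (SpecialLinearGroup (Fin 2) F) ≃
      Σ t : I, {g : SpecialLinearGroup (Fin 2) F // g.1.trace = t} :=
    { toFun := fun g => ⟨⟨g.1.1.trace, by
        simpa [hI] using (mem_cubeSet_iff_trace h3 _).1 g.2⟩, g.1, rfl⟩
      invFun := fun p => ⟨p.2.1, (mem_cubeSet_iff_trace h3 _).2 (by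
        rw [p.2.2]; exact (Finset.mem_image.1 p.1.2).imp fun _ h => h.2)⟩
      left_inv := fun _ => rfl
      right_inv := by
        rintro ⟨⟨t, ht⟩, g, hg⟩
        change g.1.trace = t at hg
        subst hg
        rfl }
  have hN : ∀ t : F, (Nat.card {g : SpecialLinearGroup (Fin 2) F // g.1.trace = t} : ℚ) =
      (Fintype.card F : ℚ) ^ 2 + Fintype.card F * quadraticChar F (t ^ 2 - 4) := fun t => by
    exact_mod_cast card_SL2_trace_eq h2 t
  rw [← Nat.card_coe_set_eq, Nat.card_congr e, Nat.card_sigma, Nat.cast_sum,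
    Finset.sum_coe_sort I fun t =>
      (Nat.card {g : SpecialLinearGroup (Fin 2) F // g.1.trace = t} : ℚ),
    Finset.sum_congr rfl fun t _ => hN t, Finset.sum_add_distrib, ← Finset.mul_sum,
    sum_image_cubic_quadraticChar h2 h3, Finset.sum_const, nsmul_eq_mul, card_image_cubic h2 h3]
  ring

end Main

theorem proposition6p3 :
    (∀ (F : Type*) [Field F] [Finite F] (q : ℕ), Nat.card F = q → ¬ 2 ∣ q → ¬ 3 ∣ q →
      (3 ∣ q - 1 →
        ((cubeClasses (Matrix.SpecialLinearGroup (Fin 2) F)).ncard : ℚ) = (2 * q + 13) / 3) ∧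
      (3 ∣ q + 1 →
        ((cubeClasses (Matrix.SpecialLinearGroup (Fin 2) F)).ncard : ℚ) = (2 * q + 11) / 3) ∧
      ((cubeSet (Matrix.SpecialLinearGroup (Fin 2) F)).ncard : ℚ) =
        2 * q * ((q : ℚ) ^ 2 - 1) / 3 ∧
      ((cubeSet (Matrix.SpecialLinearGroup (Fin 2) F)).ncard : ℚ) /
        (Nat.card (Matrix.SpecialLinearGroup (Fin 2) F) : ℚ) = 2 / 3) ∧
    (∀ ε : ℝ, 0 < ε → ∃ N : ℕ, ∀ (F : Type*) [Field F] [Finite F] (q : ℕ), Nat.card F = q →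
      ¬ 2 ∣ q → ¬ 3 ∣ q → N ≤ q →
      |((cubeClasses (Matrix.SpecialLinearGroup (Fin 2) F)).ncard : ℝ) /
        (Nat.card (ConjClasses (Matrix.SpecialLinearGroup (Fin 2) F)) : ℝ) - 2 / 3| < ε) := by
  classical
  refine ⟨fun F _ _ q hq hq2 hq3 => ?_, fun ε hε => ?_⟩
  · subst hq
    have := Fintype.ofFinite F
    have h2 : ringChar F ≠ 2 := fun h =>
      natCast_ne_zero_of_prime_not_dvd_card Nat.prime_two hq2 (h ▸ ringChar.Nat.cast_ringChar)
    have h3 : (3 : F) ≠ 0 := by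
      exact_mod_cast natCast_ne_zero_of_prime_not_dvd_card Nat.prime_three hq3
    have hc := ncard_cubeClasses_SL2 h2 h3
    have hs := ncard_cubeSet_SL2 h2 h3
    have hG : (Nat.card (SpecialLinearGroup (Fin 2) F) : ℚ) =
        (Fintype.card F : ℚ) ^ 3 - Fintype.card F := by exact_mod_cast natCard_SL2 h2
    have hgt : (1 : ℚ) < Fintype.card F := by exact_mod_cast Fintype.one_lt_card (α := F)
    rw [Nat.card_eq_fintype_card]
    refine ⟨fun h => ?_, fun h => ?_, hs, ?_⟩
    · rw [hc, quadraticChar_neg_three_eq_one h]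
      push_cast
      ring
    · have hη : quadraticChar F (-3) = -1 :=
        (quadraticChar_dichotomy (neg_ne_zero.2 h3)).resolve_left fun h1 => by
          have := three_dvd_card_sub_one h2 h3 h1
          have := Fintype.card_pos (α := F)
          omega
      rw [hc, hη]
      push_cast
      ring
    · have h1 : (Fintype.card F : ℚ) ^ 2 - 1 ≠ 0 := by nlinarith
      have h0 : (Fintype.card F : ℚ) ≠ 0 := by positivity
      rw [hs, hG, show (Fintype.card F : ℚ) ^ 3 - Fintype.card F =
        Fintype.card F * ((Fintype.card F : ℚ) ^ 2 - 1) by ring]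
      field_simp
  -- The deviation from `2/3` is `(η + 4)/(3(q + 4))`, whose numerator after dividing by `3` is at
  -- most `5/3 < 2`.
  · obtain ⟨N, hN⟩ := exists_nat_gt (2 / ε)
    refine ⟨N, fun F _ _ q hq hq2 hq3 hqN => ?_⟩
    subst hq
    have := Fintype.ofFinite F
    have h2 : ringChar F ≠ 2 := fun h =>
      natCast_ne_zero_of_prime_not_dvd_card Nat.prime_two hq2 (h ▸ ringChar.Nat.cast_ringChar)
    have h3 : (3 : F) ≠ 0 := by
      exact_mod_cast natCast_ne_zero_of_prime_not_dvd_card Nat.prime_three hq3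
    have hc : ((cubeClasses (SpecialLinearGroup (Fin 2) F)).ncard : ℝ) =
        (2 * Fintype.card F + quadraticChar F (-3)) / 3 + 4 := by
      exact_mod_cast congrArg (Rat.cast : ℚ → ℝ) (ncard_cubeClasses_SL2 h2 h3)
    rw [Nat.card_eq_fintype_card] at hqN
    have hq : (N : ℝ) ≤ Fintype.card F := by exact_mod_cast hqN
    have hpos : (0 : ℝ) < (Fintype.card F : ℝ) + 4 := by positivity
    have hlt : 2 < ε * ((Fintype.card F : ℝ) + 4) := by
      have := (div_lt_iff₀ hε).1 hN
      nlinarith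
    have hdiff : ((2 * Fintype.card F + (quadraticChar F (-3) : ℝ)) / 3 + 4) /
        ((Fintype.card F : ℝ) + 4) - 2 / 3 =
        ((quadraticChar F (-3) : ℝ) + 4) / 3 / ((Fintype.card F : ℝ) + 4) := by
      field_simp
      ring
    rw [hc, natCard_conjClasses_SL2 h2, Nat.cast_add, Nat.cast_ofNat, hdiff, abs_div,
      abs_of_pos hpos, div_lt_iff₀ hpos]
    refine lt_of_le_of_lt ?_ hlt
    rcases quadraticChar_dichotomy (neg_ne_zero.2 h3) with h | h <;> rw [h] <;>
      norm_num [abs_le]
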